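/- **Theorem (randomized $\ell_2$-heavy hitters lower bound).** For $x\in\mathbb{R}^n$ and $\epsilon>0$, call $i\in[n]$ an $\epsilon$-heavy hitter of $x$ if $|x_i|^2\ge\epsilon\|x\|_2^2$. A randomized linear sketch with $r$ rows consists of a random matrix $S\in\mathbb{R}^{r\times n}$ and a recovery algorithm (measurable in its random seed and its input) that, given its randomness (in particular $S$) and $Sx$, returns a set $L\subseteq[n]$. There are absolute constants $\delta_0,\epsilon_0\in(0,1)$ and $c>0$ such that the following holds for all $0<\delta<\delta_0$, $0<\epsilon<\epsilon_0$, all integers $n\ge\lceil 64\,\epsilon^{-1}\ln(6/\delta)\rceil$ and all integers $r\ge 0$. If a randomized linear sketch with $r$ rows has the property that for every fixed $x\in\mathbb{R}^n$, with probability at least $1-\delta$, the returned set $L$ contains all $\epsilon$-heavy hitters of $x$ and contains no item which is not an $(\epsilon/2)$-heavy hitter of $x$, then $r\ge c\,\epsilon^{-1}\ln(1/\delta)$. -/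

import Mathlib

open MeasureTheory
open scoped Matrix

/-- Coordinate `i` of `x ∈ ℝⁿ` is an `ε`-heavy hitter in the `ℓ₂` norm: `|x i|² ≥ ε ‖x‖₂²`. -/
def IsHeavyHitter {n : ℕ} (ε : ℝ) (x : EuclideanSpace ℝ (Fin n)) (i : Fin n) : Prop :=
  ε * ‖x‖ ^ 2 ≤ |x i| ^ 2

/-- The list `L` contains all `ε`-heavy hitters of `x`, and no item which is not an
`(ε / 2)`-heavy hitter of `x`. -/
def IsHeavyHitterList {n : ℕ} (ε : ℝ) (x : EuclideanSpace ℝ (Fin n))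
    (L : Finset (Fin n)) : Prop :=
  (∀ i, IsHeavyHitter ε x i → i ∈ L) ∧ (∀ i ∈ L, IsHeavyHitter (ε / 2) x i)

/-- A randomized linear sketching scheme with `r` rows for vectors in `ℝⁿ`, with random seed
`ω ∈ Ω`: a random sketching matrix, and a recovery algorithm which sees the seed (hence also the
matrix, and possibly further random bits) and the measurements `S x ∈ ℝʳ`, and returns
a list of items. -/
structure SketchingScheme (Ω : Type*) [MeasurableSpace Ω] (r n : ℕ) where
  /-- the random sketching matrix -/
  sketch : Ω → Matrix (Fin r) (Fin n) ℝ
  /-- the recovery algorithm -/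
  recover : Ω → (Fin r → ℝ) → Finset (Fin n)
  measurable_sketch : ∀ k i, Measurable fun ω => sketch ω k i
  measurable_recover : ∀ i, MeasurableSet {p : Ω × (Fin r → ℝ) | i ∈ recover p.1 p.2}

/-- The list which the scheme returns on input `x` with random seed `ω`; the recovery algorithm
accesses `x` only through the measurements. -/
def SketchingScheme.output {Ω : Type*} [MeasurableSpace Ω] {r n : ℕ} (A : SketchingScheme Ω r n)
    (ω : Ω) (x : EuclideanSpace ℝ (Fin n)) : Finset (Fin n) :=
  A.recover ω (A.sketch ω *ᵥ x.ofLp)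

/-- For every fixed input `x ∈ ℝⁿ`, the scheme returns a correct list of `ℓ₂`-heavy hitters with
probability at least `1 - δ` over its random seed. -/
def SketchingScheme.FindsHeavyHitters {Ω : Type*} [MeasurableSpace Ω] {r n : ℕ}
    (A : SketchingScheme Ω r n) (P : Measure Ω) (ε δ : ℝ) : Prop :=
  ∀ x : EuclideanSpace ℝ (Fin n), 1 - δ ≤ P.real {ω | IsHeavyHitterList ε x (A.output ω x)}

/-! Test the sketch on standard Gaussian `x` and on `x + t e_i`, with `t = 3√(εn)`. Except with
probability `δ`, coordinate `i` is not `ε/2`-heavy in the first and is `ε`-heavy in the second, so a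
correct scheme detects the raised coordinate. By Tonelli its two errors, averaged over the seed,
total at most `4δ` for each `i`.

Conversely, fix the seed. The sketch sees `e_i` only through its projection `u_i` onto the
orthogonal complement of `ker S`, and `∑ ‖u_i‖²` is the dimension of that space, at most `r`
(`exists_mulVec_eq_sum_sq_norm_le`). Separating a Gaussian from its translate by `t u_i` costs total
error at least `exp(-t²‖u_i‖²/4)/2` (`le_gaussianMeasure_add_shift`). By convexity the average over
`i` is at least `exp(-t²r/(4n))/2 = exp(-9εr/4)/2`. Comparing the bounds gives `exp(-9εr/4) ≤ 8δ`.
-/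

/-! ### Gaussian tails and the error of testing a translate. -/

section Gaussian

variable {V : Type*} [NormedAddCommGroup V] [InnerProductSpace ℝ V]

/-- The density of the standard Gaussian distribution. -/
noncomputable def gaussianDensity (x : V) : ℝ :=
  (2 * Real.pi) ^ (-(Module.finrank ℝ V / 2 : ℝ)) * Real.exp (-(1 / 2) * ‖x‖ ^ 2)

lemma gaussianDensity_pos (x : V) : 0 < gaussianDensity x := by
  unfold gaussianDensity; positivity

lemma continuous_gaussianDensity : Continuous (gaussianDensity : V → ℝ) := by
  unfold gaussianDensity; fun_prop

lemma gaussianDensity_mul_exp_inner (w x : V) :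
    gaussianDensity x * Real.exp (inner ℝ w x) =
      Real.exp (‖w‖ ^ 2 / 2) * gaussianDensity (x - w) := by
  unfold gaussianDensity
  rw [mul_assoc, ← Real.exp_add, mul_left_comm, ← Real.exp_add, norm_sub_sq_real,
    real_inner_comm]
  ring_nf

/-- Completing the square at the midpoint: the geometric mean of the two densities is a Gaussian
density scaled by their Hellinger affinity `exp(-‖v‖²/8)`. -/
lemma gaussianDensity_mul_shift (v x : V) :
    gaussianDensity x * gaussianDensity (x - v) =
      (Real.exp (-‖v‖ ^ 2 / 8) * gaussianDensity (x - (1 / 2 : ℝ) • v)) ^ 2 := by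
  have h (a b c : ℝ) : (a * (b * c)) ^ 2 = b * b * ((a * c) * (a * c)) := by ring
  unfold gaussianDensity
  rw [h, mul_mul_mul_comm, ← Real.exp_add, ← Real.exp_add, ← Real.exp_add, norm_sub_sq_real, norm_sub_sq_real, norm_smul, inner_smul_right]
  simp only [mul_pow, Real.norm_eq_abs, sq_abs]
  ring_nf

variable [FiniteDimensional ℝ V] [MeasurableSpace V] [BorelSpace V]

lemma integrable_exp_neg_mul_sq_norm {b : ℝ} (hb : 0 < b) :
    Integrable fun x : V => Real.exp (-b * ‖x‖ ^ 2) := by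
  have h := (GaussianFourier.integrable_cexp_neg_mul_sq_norm_add (V := V) (b := (b : ℂ))
    (by simpa) 0 0).re
  refine h.congr (Filter.Eventually.of_forall fun x => ?_)
  simp only [zero_mul, add_zero, RCLike.re_to_complex]
  rw [← Complex.ofReal_re (Real.exp _)]
  push_cast
  rfl

lemma integral_gaussianDensity_mul_exp {s : ℝ} (hs : s < 1 / 2) :
    Integrable (fun x : V => gaussianDensity x * Real.exp (s * ‖x‖ ^ 2)) ∧
    ∫ x : V, gaussianDensity x * Real.exp (s * ‖x‖ ^ 2) =
      Real.exp (-(Module.finrank ℝ V / 2) * Real.log (1 - 2 * s)) := by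
  have e : (fun x : V => gaussianDensity x * Real.exp (s * ‖x‖ ^ 2)) = fun x =>
      (2 * Real.pi) ^ (-(Module.finrank ℝ V / 2 : ℝ)) *
        Real.exp (-(1 / 2 - s) * ‖x‖ ^ 2) := by
    ext x
    unfold gaussianDensity
    rw [mul_assoc, ← Real.exp_add]
    ring_nf
  have hb : 0 < 1 / 2 - s := by linarith
  have hpi := Real.pi_pos
  rw [e]
  refine ⟨(integrable_exp_neg_mul_sq_norm hb).const_mul _, ?_⟩
  rw [integral_const_mul, GaussianFourier.integral_rexp_neg_mul_sq_norm hb,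
    Real.rpow_neg (by positivity), ← Real.inv_rpow (by positivity),
    ← Real.mul_rpow (by positivity) (by positivity)]
  have : (2 * Real.pi)⁻¹ * (Real.pi / (1 / 2 - s)) = (1 - 2 * s)⁻¹ := by
    have : 1 - 2 * s ≠ 0 := by linarith
    field_simp
  rw [this, Real.rpow_def_of_pos (inv_pos.2 (by linarith)), Real.log_inv]
  ring_nf

lemma integrable_gaussianDensity : Integrable (gaussianDensity : V → ℝ) := by
  simpa using (integral_gaussianDensity_mul_exp (V := V) (s := 0) (by norm_num)).1

lemma integral_gaussianDensity : ∫ x : V, gaussianDensity x = 1 := by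
  simpa using (integral_gaussianDensity_mul_exp (V := V) (s := 0) (by norm_num)).2

variable (V) in
/-- The standard Gaussian distribution, given by its density. -/
noncomputable def gaussianMeasure : Measure V :=
  volume.withDensity fun x => ENNReal.ofReal (gaussianDensity x)

instance : IsProbabilityMeasure (gaussianMeasure V) := by
  constructor
  rw [gaussianMeasure, withDensity_apply' _ _, Measure.restrict_univ,
    ← ofReal_integral_eq_lintegral_ofReal integrable_gaussianDensity
      (Filter.Eventually.of_forall fun x => (gaussianDensity_pos x).le),
    integral_gaussianDensity, ENNReal.ofReal_one]

lemma gaussianMeasure_apply (s : Set V) :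
    gaussianMeasure V s = ENNReal.ofReal (∫ x in s, gaussianDensity x) := by
  rw [gaussianMeasure, withDensity_apply' _ _,
    ← ofReal_integral_eq_lintegral_ofReal integrable_gaussianDensity.integrableOn
      (Filter.Eventually.of_forall fun x => (gaussianDensity_pos x).le)]

/-- The exponential Markov (Chernoff) bound. Since `s` need not be measurable, it is first enlarged
to the set where the integrands compare. -/
lemma gaussianMeasure_le_of_exp {F : V → ℝ} {s : Set V}
    (hF : Integrable fun x => gaussianDensity x * Real.exp (F x)) {c : ℝ}
    (hs : ∀ x ∈ s, c ≤ F x) :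
    gaussianMeasure V s ≤
      ENNReal.ofReal (Real.exp (-c) * ∫ x, gaussianDensity x * Real.exp (F x)) := by
  rw [gaussianMeasure, withDensity_apply' _ _, ← integral_const_mul,
    ofReal_integral_eq_lintegral_ofReal (hF.const_mul _)
      (Filter.Eventually.of_forall fun x => by have := gaussianDensity_pos x; positivity)]
  set f : V → ENNReal := fun x =>
    ENNReal.ofReal (Real.exp (-c) * (gaussianDensity x * Real.exp (F x)))
  have hle : s ⊆ {x | ENNReal.ofReal (gaussianDensity x) ≤ f x} := by
    intro x hx
    refine ENNReal.ofReal_le_ofReal ?_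
    rw [mul_left_comm, ← Real.exp_add]
    exact le_mul_of_one_le_right (gaussianDensity_pos x).le
      (Real.one_le_exp (by linarith [hs x hx]))
  have hm : AEMeasurable f :=
    (hF.const_mul _).aestronglyMeasurable.aemeasurable.ennreal_ofReal
  have hS : NullMeasurableSet {x | ENNReal.ofReal (gaussianDensity x) ≤ f x} :=
    nullMeasurableSet_le continuous_gaussianDensity.measurable.ennreal_ofReal.aemeasurable hm
  calc ∫⁻ x in s, ENNReal.ofReal (gaussianDensity x)
      ≤ ∫⁻ x in {x | ENNReal.ofReal (gaussianDensity x) ≤ f x},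
          ENNReal.ofReal (gaussianDensity x) := lintegral_mono_set hle
    _ ≤ ∫⁻ x in {x | ENNReal.ofReal (gaussianDensity x) ≤ f x}, f x :=
        lintegral_mono_ae ((ae_restrict_iff'₀ hS).2 (Filter.Eventually.of_forall fun _ h => h))
    _ ≤ ∫⁻ x, f x := setLIntegral_le_lintegral _ _

/-- Positive `s` gives the upper tail of `‖x‖²`, negative `s` the lower one. -/
lemma gaussianMeasure_sq_norm_tail {s : ℝ} (hs : s < 1 / 2) (c : ℝ) :
    gaussianMeasure V {x | c ≤ s * ‖x‖ ^ 2} ≤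
      ENNReal.ofReal (Real.exp (-c - (Module.finrank ℝ V / 2) * Real.log (1 - 2 * s))) := by
  have h := integral_gaussianDensity_mul_exp (V := V) hs
  refine (gaussianMeasure_le_of_exp h.1 (c := c) fun x hx => hx).trans_eq ?_
  rw [h.2, ← Real.exp_add]
  ring_nf

lemma gaussianMeasure_inner_tail (w : V) :
    gaussianMeasure V {x | ‖w‖ ^ 2 ≤ inner ℝ w x} ≤
      ENNReal.ofReal (Real.exp (-(‖w‖ ^ 2 / 2))) := by
  have e : (fun x : V => gaussianDensity x * Real.exp (inner ℝ w x)) = fun x =>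
      Real.exp (‖w‖ ^ 2 / 2) * gaussianDensity (x - w) :=
    funext (gaussianDensity_mul_exp_inner w)
  have hi : Integrable fun x : V => gaussianDensity x * Real.exp (inner ℝ w x) := by
    rw [e]
    exact (integrable_gaussianDensity.comp_sub_right w).const_mul _
  refine (gaussianMeasure_le_of_exp hi fun x hx => hx).trans_eq ?_
  rw [e, integral_const_mul, integral_sub_right_eq_self, integral_gaussianDensity, mul_one,
    ← Real.exp_add]
  ring_nf

/-- A test between the standard Gaussian and its translate by `v` errs with total probability at
least `exp (-‖v‖² / 4) / 2`. -/
lemma le_gaussianMeasure_add_shift (v : V) {s : Set V} (hs : MeasurableSet s) :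
    ENNReal.ofReal (Real.exp (-(‖v‖ ^ 2 / 4)) / 2) ≤
      gaussianMeasure V s + gaussianMeasure V {x | x + v ∉ s} := by
  have hnonneg (t : Set V) : 0 ≤ ∫ x in t, gaussianDensity x :=
    integral_nonneg fun x => (gaussianDensity_pos x).le
  rw [gaussianMeasure_apply, gaussianMeasure_apply,
    ← ENNReal.ofReal_add (hnonneg _) (hnonneg _)]
  refine ENNReal.ofReal_le_ofReal ?_
  set ρ := Real.exp (-‖v‖ ^ 2 / 8) with hρ
  have hρ0 : 0 < ρ := Real.exp_pos _
  have hρ2 : Real.exp (-(‖v‖ ^ 2 / 4)) = ρ ^ 2 := by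
    rw [hρ, ← Real.exp_nat_mul]; push_cast; ring_nf
  have hshift : ∫ x in {x | x + v ∉ s}, gaussianDensity x =
      ∫ x in sᶜ, gaussianDensity (x - v) := by
    have hm : MeasurableSet {x | x + v ∉ s} := (measurable_add_const v) hs.compl
    rw [← integral_indicator hm, ← integral_indicator hs.compl,
      ← integral_sub_right_eq_self _ v]
    refine integral_congr_ae (Filter.Eventually.of_forall fun x => ?_)
    by_cases hx : x ∈ s <;> simp [Set.indicator, hx]
  rw [hshift, hρ2, ← integral_indicator hs, ← integral_indicator hs.compl]
  have i0 : Integrable (gaussianDensity : V → ℝ) := integrable_gaussianDensity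
  have i1 (w : V) : Integrable fun x : V => gaussianDensity (x - w) := i0.comp_sub_right w
  have j0 := i0.indicator hs
  have j1 := (i1 v).indicator hs.compl
  -- With `p`, `q` the two densities and `m` the midpoint one, `pq = (ρm)²`, so AM-GM gives `ρ²m ≤
  -- min(p, q) + ρ²(p + q)/4`. Integrating yields `ρ² ≤ error + ρ²/2`.
  have key : ∫ x : V, ρ ^ 2 * gaussianDensity (x - (1 / 2 : ℝ) • v) ≤
      ∫ x : V, ((s.indicator gaussianDensity x +
        sᶜ.indicator (fun x => gaussianDensity (x - v)) x) +
        ρ ^ 2 / 4 * (gaussianDensity x + gaussianDensity (x - v))) := by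
    refine integral_mono ((i1 _).const_mul _)
      ((j0.add j1).add ((i0.add (i1 v)).const_mul _)) fun x => ?_
    have h := gaussianDensity_mul_shift v x
    have hp := gaussianDensity_pos x
    have hq := gaussianDensity_pos (x - v)
    have hm := gaussianDensity_pos (x - (1 / 2 : ℝ) • v)
    have amgm (p q m : ℝ) (hp : 0 < p) (hq : 0 < q) (hm : 0 < m) (h : p * q = (ρ * m) ^ 2) :
        ρ ^ 2 * m ≤ p + ρ ^ 2 / 4 * (p + q) := by
      have : ρ ^ 2 * m ≤ p + ρ ^ 2 / 4 * q := by
        refine abs_le_of_sq_le_sq' ?_ (by positivity) |>.2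
        have : (ρ ^ 2 * m) ^ 2 = ρ ^ 2 * (p * q) := by rw [h]; ring
        rw [this]
        nlinarith [sq_nonneg (p - ρ ^ 2 / 4 * q)]
      have : 0 ≤ ρ ^ 2 / 4 * p := by positivity
      linarith
    by_cases hx : x ∈ s
    · simpa [hx] using amgm _ _ _ hp hq hm h
    · have := amgm _ _ _ hq hp hm ((mul_comm _ _).trans h)
      simpa [hx, add_comm (gaussianDensity (x - v)) (gaussianDensity x)] using this
  have e1 := integral_add (j0.add j1) ((i0.add (i1 v)).const_mul (ρ ^ 2 / 4))
  simp only [Pi.add_apply] at e1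
  rw [integral_const_mul, e1, integral_add j0 j1, integral_const_mul, integral_add i0 (i1 v),
    integral_sub_right_eq_self, integral_sub_right_eq_self, integral_gaussianDensity] at key
  linarith

end Gaussian
-- Projections of the basis vectors modulo the kernel.
section Projection

variable {n r : ℕ}

/-- Modulo the kernel of an `r`-row matrix, the standard basis vectors have total squared norm
at most `r`. -/
lemma exists_mulVec_eq_sum_sq_norm_le (S : Matrix (Fin r) (Fin n) ℝ) :
    ∃ u : Fin n → EuclideanSpace ℝ (Fin n),
      (∀ i, S *ᵥ (u i).ofLp = S *ᵥ (EuclideanSpace.single i (1 : ℝ)).ofLp) ∧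
      ∑ i, ‖u i‖ ^ 2 ≤ r := by
  set T := Matrix.toEuclideanLin S
  set K := (LinearMap.ker T)ᗮ
  refine ⟨fun i => K.starProjection (EuclideanSpace.single i 1), fun i => ?_, ?_⟩
  · have h : EuclideanSpace.single i 1 - K.starProjection (EuclideanSpace.single i 1) ∈
        LinearMap.ker T := by
      have := K.sub_starProjection_mem_orthogonal (EuclideanSpace.single i (1 : ℝ))
      rwa [Submodule.orthogonal_orthogonal] at this
    rw [LinearMap.mem_ker, map_sub, sub_eq_zero] at h
    have h' := congrArg WithLp.ofLp h
    simpa [T, Matrix.toEuclideanLin, Matrix.toLpLin_apply] using h'.symm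
  -- The sum of squared norms is the trace of the projection, hence the dimension of `K`, which is
  -- the rank of `S`.
  · have htr : LinearMap.trace ℝ _ (K.starProjection : _ →ₗ[ℝ] EuclideanSpace ℝ (Fin n)) =
        ∑ i, ‖K.starProjection (EuclideanSpace.single i (1 : ℝ))‖ ^ 2 := by
      rw [LinearMap.trace_eq_sum_inner _ (EuclideanSpace.basisFun (Fin n) ℝ)]
      refine Finset.sum_congr rfl fun i _ => ?_
      rw [← real_inner_self_eq_norm_sq, Submodule.inner_starProjection_left_eq_right,
        K.starProjection_eq_self_iff.2 (K.starProjection_apply_mem _)]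
      simp
    have hproj : LinearMap.IsProj K (K.starProjection : _ →ₗ[ℝ] EuclideanSpace ℝ (Fin n)) :=
      ⟨fun x => K.starProjection_apply_mem x, fun x hx => K.starProjection_eq_self_iff.2 hx⟩
    rw [← htr, hproj.trace]
    have h1 : _ + Module.finrank ℝ K = _ := (LinearMap.ker T).finrank_add_finrank_orthogonal
    have h2 := LinearMap.finrank_range_add_finrank_ker T
    have h3 := (LinearMap.range T).finrank_le
    rw [finrank_euclideanSpace_fin] at h1 h2 h3
    have : Module.finrank ℝ K ≤ r := by omega
    exact_mod_cast this

end Projection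

/-- Jensen's inequality for `exp`, from its tangent line at `m`. -/
lemma card_mul_exp_le_sum_exp {n : ℕ} (y : Fin n → ℝ) {m : ℝ} (h : n * m ≤ ∑ i, y i) :
    n * Real.exp m ≤ ∑ i, Real.exp (y i) := by
  have h1 : ∀ i, Real.exp m * (1 + (y i - m)) ≤ Real.exp (y i) := fun i => by
    have := mul_le_mul_of_nonneg_left (Real.add_one_le_exp (y i - m)) (Real.exp_pos m).le
    rw [← Real.exp_add] at this
    simpa [add_comm] using this
  refine le_trans ?_ (Finset.sum_le_sum fun i _ => h1 i)
  rw [← Finset.mul_sum, Finset.sum_add_distrib, Finset.sum_sub_distrib]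
  simp only [Finset.sum_const, Finset.card_univ, Fintype.card_fin, nsmul_eq_mul, mul_one]
  nlinarith [Real.exp_pos m]

/-! ### Heaviness of a Gaussian coordinate, before and after raising it. -/

section HeavyHitters

variable {n : ℕ} {ε δ : ℝ}

lemma gaussianMeasure_coord_tail (i : Fin n) (a : ℝ) :
    gaussianMeasure (EuclideanSpace ℝ (Fin n)) {x | a ^ 2 ≤ a * x i} ≤
      ENNReal.ofReal (Real.exp (-(a ^ 2 / 2))) := by
  simpa [EuclideanSpace.inner_single_left] using
    gaussianMeasure_inner_tail (EuclideanSpace.single i a)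

/-- If `‖x‖² > n/2`, heaviness forces `x_i² ≥ εn/4 = a²`. The lower norm tail and the two coordinate
tails each cost at most `δ/6`. -/
lemma gaussianMeasure_isHeavyHitter_le (hε : 0 < ε) (hε1 : ε < 1) (hδ : 0 < δ) (hδ1 : δ < 1)
    (hn : 64 * Real.log (6 / δ) ≤ ε * n) (i : Fin n) :
    gaussianMeasure (EuclideanSpace ℝ (Fin n)) {x | IsHeavyHitter (ε / 2) x i} ≤
      ENNReal.ofReal δ := by
  set L := Real.log (6 / δ)
  have hL : 0 < L := Real.log_pos (by rw [lt_div_iff₀ hδ]; linarith)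
  have hexp : Real.exp (-L) = δ / 6 := by
    rw [Real.exp_neg, Real.exp_log (by positivity), inv_div]
  have hnn : (0 : ℝ) ≤ n := n.cast_nonneg
  have hnL : 64 * L ≤ n := by nlinarith
  set a := √(ε * n) / 2
  have ha : a ^ 2 = ε * n / 4 := by
    rw [div_pow, Real.sq_sqrt (by positivity)]; norm_num
  have ha0 : 0 ≤ a := by positivity
  have hsub : {x : EuclideanSpace ℝ (Fin n) | IsHeavyHitter (ε / 2) x i} ⊆
      {x | -(n / 4 : ℝ) ≤ -(1 / 2) * ‖x‖ ^ 2} ∪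
        ({x | a ^ 2 ≤ a * x i} ∪ {x | (-a) ^ 2 ≤ -a * x i}) := by
    intro x hx
    simp only [Set.mem_ofPred_eq, IsHeavyHitter, sq_abs] at hx
    by_cases h : -(n / 4 : ℝ) ≤ -(1 / 2) * ‖x‖ ^ 2
    · exact Or.inl h
    refine Or.inr ?_
    have h1 : a ^ 2 ≤ x i ^ 2 := by rw [ha]; nlinarith
    have h2 : a ≤ |x i| := abs_le_of_sq_le_sq' (by rwa [sq_abs]) (abs_nonneg _) |>.2
    rcases le_abs'.1 h2 with h3 | h3
    · right; simp only [Set.mem_ofPred_eq]; nlinarith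
    · left; simp only [Set.mem_ofPred_eq]; nlinarith
  have hb : Real.exp (-(a ^ 2 / 2)) ≤ δ / 6 := by
    rw [← hexp, ha]; exact Real.exp_le_exp.2 (by linarith)
  have t1 := gaussianMeasure_sq_norm_tail (V := EuclideanSpace ℝ (Fin n)) (s := -(1 / 2))
    (by norm_num) (-(n / 4))
  have t2 := gaussianMeasure_coord_tail i a
  have t3 := gaussianMeasure_coord_tail i (-a)
  rw [neg_sq] at t3
  have hc : Real.exp (-(-(n / 4 : ℝ)) - (Module.finrank ℝ (EuclideanSpace ℝ (Fin n)) / 2) *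
      Real.log (1 - 2 * -(1 / 2))) ≤ δ / 6 := by
    rw [← hexp, finrank_euclideanSpace_fin]
    norm_num
    nlinarith [Real.log_two_gt_d9]
  calc _ ≤ _ := measure_mono hsub
    _ ≤ _ := (measure_union_le _ _).trans (add_le_add le_rfl (measure_union_le _ _))
    _ ≤ ENNReal.ofReal (δ / 6) + (ENNReal.ofReal (δ / 6) + ENNReal.ofReal (δ / 6)) := by
      rw [neg_sq]
      exact add_le_add (t1.trans (ENNReal.ofReal_le_ofReal hc))
        (add_le_add (t2.trans (ENNReal.ofReal_le_ofReal hb))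
          (t3.trans (ENNReal.ofReal_le_ofReal hb)))
    _ ≤ ENNReal.ofReal δ := by
      rw [← ENNReal.ofReal_add (by positivity) (by positivity),
        ← ENNReal.ofReal_add (by positivity) (by positivity)]
      exact ENNReal.ofReal_le_ofReal (by linarith)

lemma sq_norm_add_single_le (x : EuclideanSpace ℝ (Fin n)) (i : Fin n) (t : ℝ) :
    ‖x + EuclideanSpace.single i t‖ ^ 2 ≤ ‖x‖ ^ 2 + (x i + t) ^ 2 := by
  rw [norm_add_sq_real, real_inner_comm, EuclideanSpace.inner_single_left,
    PiLp.norm_single]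
  simp only [conj_trivial, Real.norm_eq_abs, sq_abs]
  nlinarith [sq_nonneg (x i)]

/-- Typically `‖x‖² < 2n` and `x_i > -a`, so the raised coordinate is at least `2a`; then `(1 -
ε)(2a)² ≥ 2εn` because `ε < 1/2`. -/
lemma gaussianMeasure_not_isHeavyHitter_le (hε : 0 < ε) (hε1 : ε < 1 / 2) (hδ : 0 < δ)
    (hδ1 : δ < 1) (hn : 64 * Real.log (6 / δ) ≤ ε * n) (i : Fin n) :
    gaussianMeasure (EuclideanSpace ℝ (Fin n))
      {x | ¬ IsHeavyHitter ε (x + EuclideanSpace.single i (3 * √(ε * n))) i} ≤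
      ENNReal.ofReal δ := by
  set L := Real.log (6 / δ)
  have hL : 0 < L := Real.log_pos (by rw [lt_div_iff₀ hδ]; linarith)
  have hexp : Real.exp (-L) = δ / 6 := by
    rw [Real.exp_neg, Real.exp_log (by positivity), inv_div]
  have hnn : (0 : ℝ) ≤ n := n.cast_nonneg
  have hnL : 64 * L ≤ n := by nlinarith
  set a := √(ε * n)
  have ha : a ^ 2 = ε * n := Real.sq_sqrt (by positivity)
  have ha0 : 0 ≤ a := by positivity
  have hsub : {x : EuclideanSpace ℝ (Fin n) |
        ¬ IsHeavyHitter ε (x + EuclideanSpace.single i (3 * a)) i} ⊆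
      {x | (n / 2 : ℝ) ≤ 1 / 4 * ‖x‖ ^ 2} ∪ {x | (-a) ^ 2 ≤ -a * x i} := by
    intro x hx
    by_contra hc
    simp only [Set.mem_union, Set.mem_ofPred_eq, not_or, not_le] at hc
    obtain ⟨h1, h2⟩ := hc
    refine hx ?_
    have h3 := sq_norm_add_single_le x i (3 * a)
    have h4 : 2 * a ≤ x i + 3 * a := by
      by_contra h
      nlinarith
    have h5 : (2 * a) ^ 2 ≤ (x i + 3 * a) ^ 2 := pow_le_pow_left₀ (by positivity) h4 2
    have h6 : ε * ‖x‖ ^ 2 ≤ ε * (2 * n) := mul_le_mul_of_nonneg_left (by linarith) hε.le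
    have h7 := mul_le_mul_of_nonneg_left h3 hε.le
    simp only [IsHeavyHitter, sq_abs, PiLp.add_apply, PiLp.single_apply, if_true]
    nlinarith
  have hb : Real.exp (-((-a) ^ 2 / 2)) ≤ δ / 6 := by
    rw [← hexp, neg_sq, ha]; exact Real.exp_le_exp.2 (by linarith)
  have t1 := gaussianMeasure_sq_norm_tail (V := EuclideanSpace ℝ (Fin n)) (s := 1 / 4)
    (by norm_num) (n / 2)
  have t2 := gaussianMeasure_coord_tail i (-a)
  have hc : Real.exp (-(n / 2 : ℝ) - (Module.finrank ℝ (EuclideanSpace ℝ (Fin n)) / 2) *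
      Real.log (1 - 2 * (1 / 4))) ≤ δ / 6 := by
    have : Real.log (1 - 2 * (1 / 4)) = -Real.log 2 := by
      rw [← Real.log_inv]; norm_num
    rw [← hexp, finrank_euclideanSpace_fin, this]
    refine Real.exp_le_exp.2 ?_
    nlinarith [Real.log_two_lt_d9]
  calc _ ≤ _ := measure_mono hsub
    _ ≤ _ := measure_union_le _ _
    _ ≤ ENNReal.ofReal (δ / 6) + ENNReal.ofReal (δ / 6) :=
      add_le_add (t1.trans (ENNReal.ofReal_le_ofReal hc))
          (t2.trans (ENNReal.ofReal_le_ofReal hb))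
    _ ≤ ENNReal.ofReal δ := by
      rw [← ENNReal.ofReal_add (by positivity) (by positivity)]
      exact ENNReal.ofReal_le_ofReal (by linarith)

end HeavyHitters

/-! ### Comparing the errors for a fixed seed with those for a fixed input. -/

namespace SketchingScheme

variable {Ω : Type*} [MeasurableSpace Ω] {r n : ℕ} (A : SketchingScheme Ω r n)

lemma measurableSet_mem_output (i : Fin n) :
    MeasurableSet {p : Ω × EuclideanSpace ℝ (Fin n) | i ∈ A.output p.1 p.2} := by
  have hm : Measurable fun p : Ω × EuclideanSpace ℝ (Fin n) =>
      (p.1, A.sketch p.1 *ᵥ p.2.ofLp) := by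
    refine measurable_fst.prodMk (measurable_pi_iff.2 fun k => ?_)
    simp only [Matrix.mulVec, dotProduct]
    refine Finset.measurable_fun_sum _ fun j _ => ?_
    refine ((A.measurable_sketch k j).comp measurable_fst).mul ?_
    exact (by fun_prop : Measurable fun x : EuclideanSpace ℝ (Fin n) => x.ofLp j).comp
      measurable_snd
  exact hm (A.measurable_recover i)

/-- For a fixed seed, the error probabilities in deciding whether coordinate `i` has been raised
by `t` add up to a lot, on average over `i`. -/
lemma le_sum_error (ω : Ω) (hn : 0 < n) (t : ℝ) :
    ENNReal.ofReal (n * (Real.exp (-(t ^ 2 * r / (4 * n))) / 2)) ≤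
      ∑ i, (gaussianMeasure _ {x | i ∈ A.output ω x} +
        gaussianMeasure _ {x | i ∉ A.output ω (x + EuclideanSpace.single i t)}) := by
  obtain ⟨u, hu, hsum⟩ := exists_mulVec_eq_sum_sq_norm_le (A.sketch ω)
  have hn' : (0 : ℝ) < n := by exact_mod_cast hn
  have hout (i : Fin n) (x : EuclideanSpace ℝ (Fin n)) :
      A.output ω (x + EuclideanSpace.single i t) = A.output ω (x + t • u i) := by
    have : EuclideanSpace.single i t = t • EuclideanSpace.single i (1 : ℝ) := by
      ext j; simp
    unfold output
    rw [this]
    simp only [WithLp.ofLp_add, WithLp.ofLp_smul, Matrix.mulVec_add, Matrix.mulVec_smul, hu]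
  have hi (i : Fin n) : ENNReal.ofReal (Real.exp (-(‖t • u i‖ ^ 2 / 4)) / 2) ≤
      gaussianMeasure _ {x | i ∈ A.output ω x} +
        gaussianMeasure _ {x | i ∉ A.output ω (x + EuclideanSpace.single i t)} := by
    simp only [hout]
    exact le_gaussianMeasure_add_shift (t • u i)
      (s := {x | i ∈ A.output ω x}) (measurable_prodMk_left (A.measurableSet_mem_output i))
  refine le_trans ?_ (Finset.sum_le_sum fun i _ => hi i)
  rw [← ENNReal.ofReal_sum_of_nonneg fun i _ => by positivity]
  refine ENNReal.ofReal_le_ofReal ?_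
  rw [← Finset.sum_div, ← mul_div_assoc]
  refine div_le_div_of_nonneg_right (card_mul_exp_le_sum_exp _ ?_) (by norm_num)
  rw [Finset.sum_neg_distrib, ← Finset.sum_div]
  simp only [norm_smul, mul_pow, Real.norm_eq_abs, sq_abs]
  rw [← Finset.mul_sum]
  have : (n : ℝ) * -(t ^ 2 * r / (4 * n)) = -(t ^ 2 * r / 4) := by field_simp
  rw [this]
  have := mul_le_mul_of_nonneg_left hsum (sq_nonneg t)
  linarith

variable {A} {P : Measure Ω} [IsProbabilityMeasure P] {ε δ : ℝ}

lemma FindsHeavyHitters.measure_fail_le (hA : A.FindsHeavyHitters P ε δ)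
    (x : EuclideanSpace ℝ (Fin n)) :
    P {ω | ¬ IsHeavyHitterList ε x (A.output ω x)} ≤ ENNReal.ofReal δ := by
  have hm : MeasurableSet {ω | IsHeavyHitterList ε x (A.output ω x)} := by
    have h (i : Fin n) : MeasurableSet {ω | i ∈ A.output ω x} :=
      measurable_prodMk_right (A.measurableSet_mem_output i)
    have e : {ω | IsHeavyHitterList ε x (A.output ω x)} =
        (⋂ i, {ω | IsHeavyHitter ε x i → i ∈ A.output ω x}) ∩
          ⋂ i, {ω | i ∈ A.output ω x → IsHeavyHitter (ε / 2) x i} := by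
      ext ω; simp [IsHeavyHitterList]
    rw [e]
    refine (MeasurableSet.iInter fun i => ?_).inter (MeasurableSet.iInter fun i => ?_)
    · exact (MeasurableSet.const _).imp (h i)
    · exact (h i).imp (MeasurableSet.const _)
  have h1 := hA x
  have h2 := probReal_compl_eq_one_sub (μ := P) hm
  have h3 : P.real {ω | ¬ IsHeavyHitterList ε x (A.output ω x)} ≤ δ := by
    change P.real {ω | IsHeavyHitterList ε x (A.output ω x)}ᶜ ≤ δ
    linarith
  rw [← ofReal_measureReal]
  exact ENNReal.ofReal_le_ofReal h3

/-- If `B x ω` only happens when the scheme fails on `f x`, except for `x` in a set of small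
measure, then `B` has small probability. -/
lemma FindsHeavyHitters.lintegral_le (hA : A.FindsHeavyHitters P ε δ)
    {γ : Measure (EuclideanSpace ℝ (Fin n))} [IsProbabilityMeasure γ]
    {f : EuclideanSpace ℝ (Fin n) → EuclideanSpace ℝ (Fin n)}
    {B : EuclideanSpace ℝ (Fin n) → Set Ω} {T : Set (EuclideanSpace ℝ (Fin n))}
    (hT : γ T ≤ ENNReal.ofReal δ)
    (hB : ∀ x ∉ T, B x ⊆ {ω | ¬ IsHeavyHitterList ε (f x) (A.output ω (f x))}) :
    ∫⁻ x, P (B x) ∂γ ≤ ENNReal.ofReal δ + ENNReal.ofReal δ := by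
  calc ∫⁻ x, P (B x) ∂γ
      -- On the measurable hull of `T` the trivial bound `1` is used, elsewhere the failure
      -- probability.
      ≤ ∫⁻ x, (ENNReal.ofReal δ + (toMeasurable γ T).indicator 1 x) ∂γ := by
        refine lintegral_mono fun x => ?_
        by_cases hx : x ∈ toMeasurable γ T
        · simpa [hx] using (prob_le_one (μ := P)).trans le_add_self
        · have hx' : x ∉ T := fun h => hx (subset_toMeasurable γ T h)
          simpa [hx] using (measure_mono (hB x hx')).trans (hA.measure_fail_le (f x))
    _ = ENNReal.ofReal δ + γ T := by
        rw [lintegral_add_left measurable_const,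
          lintegral_indicator_one (measurableSet_toMeasurable _ _), measure_toMeasurable]
        simp
    _ ≤ _ := add_le_add le_rfl hT

lemma FindsHeavyHitters.exp_le (hA : A.FindsHeavyHitters P ε δ) (hε : 0 < ε) (hε1 : ε < 1 / 2)
    (hδ : 0 < δ) (hδ1 : δ < 1) (hn : 64 * Real.log (6 / δ) ≤ ε * n) :
    Real.exp (-(9 * ε * r / 4)) ≤ 8 * δ := by
  have hn0 : 0 < n := by
    have hL : 0 < Real.log (6 / δ) := Real.log_pos (by rw [lt_div_iff₀ hδ]; linarith)
    rcases Nat.eq_zero_or_pos n with h | h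
    · rw [h] at hn; simp at hn; linarith
    · exact h
  have hn' : (0 : ℝ) < n := by exact_mod_cast hn0
  set t := 3 * √(ε * n)
  have ht : t ^ 2 * r / (4 * n) = 9 * ε * r / 4 := by
    rw [mul_pow, Real.sq_sqrt (by positivity)]; field_simp; ring
  set γ := gaussianMeasure (EuclideanSpace ℝ (Fin n))
  have hM (i : Fin n) := A.measurableSet_mem_output i
  have hM' (i : Fin n) : MeasurableSet {p : Ω × EuclideanSpace ℝ (Fin n) |
      i ∉ A.output p.1 (p.2 + EuclideanSpace.single i t)} :=
    (measurable_fst.prodMk (measurable_snd.add_const (EuclideanSpace.single i t))) (hM i).compl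
  -- Tonelli moves the seed integral inside, so that the guarantee for a fixed input applies.
  have ha (i : Fin n) : ∫⁻ ω, γ {x | i ∈ A.output ω x} ∂P ≤
      ENNReal.ofReal δ + ENNReal.ofReal δ := by
    refine ((Measure.prod_apply (μ := P) (ν := γ) (hM i)).symm.trans
      (Measure.prod_apply_symm (hM i))).trans_le ?_
    refine hA.lintegral_le (f := id) (gaussianMeasure_isHeavyHitter_le hε (by linarith) hδ hδ1 hn i)
      fun x hx ω hω hl => hx (hl.2 i hω)
  have hb (i : Fin n) : ∫⁻ ω, γ {x | i ∉ A.output ω (x + EuclideanSpace.single i t)} ∂P ≤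
      ENNReal.ofReal δ + ENNReal.ofReal δ := by
    refine ((Measure.prod_apply (μ := P) (ν := γ) (hM' i)).symm.trans
      (Measure.prod_apply_symm (hM' i))).trans_le ?_
    refine hA.lintegral_le (f := fun x => x + EuclideanSpace.single i t)
      (gaussianMeasure_not_isHeavyHitter_le hε hε1 hδ hδ1 hn i)
      fun x hx ω hω hl => hω (hl.1 i (not_not.1 hx))
  have key : ENNReal.ofReal (n * (Real.exp (-(t ^ 2 * r / (4 * n))) / 2)) ≤
      ENNReal.ofReal (n * (4 * δ)) := by
    calc _ = ∫⁻ _, ENNReal.ofReal (n * (Real.exp (-(t ^ 2 * r / (4 * n))) / 2)) ∂P := by simp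
      _ ≤ _ := lintegral_mono fun ω => A.le_sum_error ω hn0 t
      _ = ∑ i, (∫⁻ ω, γ {x | i ∈ A.output ω x} ∂P +
          ∫⁻ ω, γ {x | i ∉ A.output ω (x + EuclideanSpace.single i t)} ∂P) := by
        have m1 (i : Fin n) : Measurable fun ω => γ {x | i ∈ A.output ω x} :=
          measurable_measure_prodMk_left (hM i)
        have m2 (i : Fin n) : Measurable fun ω =>
            γ {x | i ∉ A.output ω (x + EuclideanSpace.single i t)} :=
          measurable_measure_prodMk_left (hM' i)
        refine (lintegral_finsetSum _ fun i _ => (m1 i).add (m2 i)).trans ?_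
        exact Finset.sum_congr rfl fun i _ => lintegral_add_left (m1 i) _
      _ ≤ ∑ _i : Fin n, ENNReal.ofReal (4 * δ) := by
        refine Finset.sum_le_sum fun i _ => (add_le_add (ha i) (hb i)).trans_eq ?_
        rw [← ENNReal.ofReal_add hδ.le hδ.le,
          ← ENNReal.ofReal_add (by positivity) (by positivity)]
        ring_nf
      _ = _ := by
        rw [Finset.sum_const, Finset.card_univ, Fintype.card_fin, nsmul_eq_mul,
          ENNReal.ofReal_mul hn'.le, ENNReal.ofReal_natCast]
  rw [ENNReal.ofReal_le_ofReal_iff (by positivity), ht] at key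
  have := le_of_mul_le_mul_left key hn'
  linarith

end SketchingScheme

theorem mainTheorem3 :
    ∃ δ₀ ∈ Set.Ioo (0 : ℝ) 1, ∃ ε₀ ∈ Set.Ioo (0 : ℝ) 1, ∃ c : ℝ, 0 < c ∧
      ∀ δ ε : ℝ, 0 < δ → δ < δ₀ → 0 < ε → ε < ε₀ →
      ∀ n r : ℕ, ⌈64 * ε⁻¹ * Real.log (6 / δ)⌉₊ ≤ n →
      ∀ (Ω : Type*) [MeasurableSpace Ω] (P : Measure Ω) [IsProbabilityMeasure P]
        (A : SketchingScheme Ω r n), A.FindsHeavyHitters P ε δ →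
        c * ε⁻¹ * Real.log (1 / δ) ≤ (r : ℝ) := by
  -- For `δ < 1/64`, `(8δ)² ≤ δ`: the factor `8` is absorbed by halving the constant `4/9`.
  refine ⟨1 / 64, by norm_num, 1 / 2, by norm_num, 2 / 9, by norm_num, ?_⟩
  intro δ ε hδ hδ0 hε hε0 n r hn Ω _ P _ A hA
  have hn1 : 64 * ε⁻¹ * Real.log (6 / δ) ≤ n := Nat.ceil_le.1 hn
  have hn2 : 64 * Real.log (6 / δ) ≤ ε * n := by
    have := mul_le_mul_of_nonneg_left hn1 hε.le
    have e : ε * (64 * ε⁻¹ * Real.log (6 / δ)) = 64 * Real.log (6 / δ) := by field_simp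
    linarith
  have h := hA.exp_le hε hε0 hδ (by linarith) hn2
  have h1 : -(9 * ε * r / 4) ≤ Real.log (8 * δ) :=
    (Real.le_log_iff_exp_le (by positivity)).2 h
  have h2 : 2 * Real.log (8 * δ) ≤ Real.log δ := by
    have : 2 * Real.log (8 * δ) = Real.log ((8 * δ) ^ 2) := by rw [Real.log_pow]; norm_num
    rw [this]
    exact Real.log_le_log (by positivity) (by nlinarith)
  rw [one_div, Real.log_inv]
  have h3 : -Real.log δ ≤ ε * (9 / 2 * r) := by linarith
  have h4 := mul_le_mul_of_nonneg_left h3 (inv_nonneg.2 hε.le)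
  rw [inv_mul_cancel_left₀ hε.ne'] at h4
  linarith
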